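/- Let $\Gamma=(V,E)$ be a finite connected acyclic graph and let $v\in V$. On the Hilbert space $W_v=(\mathbb{C}^2)^{\otimes (V\setminus\{v\})}$, with one qubit for each vertex other than $v$, let $X_w$ and $Z_w$ denote the Pauli operators $X$ and $Z$ acting on the qubit $w$. Let $\langle S\rangle_{\mathrm{Lie}}$ denote the real Lie algebra generated by a set $S$ of operators under the commutator. The standard reduced dynamical Lie algebra of $(\Gamma,v)$ is $$\mathfrak{g}^{v}_{\Gamma,\mathrm{std}}=\Big\langle\, i\sum_{w\ne v}X_w,\;\; i\Big(\sum_{\{w,w'\}\in E,\ w,w'\neq v}Z_wZ_{w'}+\sum_{\{v,w\}\in E}Z_w\Big)\Big\rangle_{\mathrm{Lie}} .$$ Let $\Gamma_v$ be the graph obtained from $\Gamma$ by deleting $v$ and all edges incident to it; its free dynamical Lie algebra is $$\mathfrak{g}_{\Gamma_v,\mathrm{free}}=\Big\langle \{iX_w : w\in V\setminus\{v\}\}\cup\{iZ_wZ_{w'} : \{w,w'\}\in E,\ w,w'\neq v\}\Big\rangle_{\mathrm{Lie}} .$$ For $w\in V$ at distance $j\geq 1$ from $v$, let $v=w_0,w_1,\dots,w_j=w$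 be the unique path from $v$ to $w$, and call $(\deg w_1,\dots,\deg w_j)\in(\mathbb{Z}/2)^j$ (degrees taken in $\Gamma$ and reduced modulo $2$) the parity-degree sequence of $w$. A leaf is a vertex of degree $1$ in $\Gamma$. Suppose that for every integer $j>0$ the parity-degree sequences of the leaves of $\Gamma$ at distance $j$ from $v$ are pairwise distinct. Then $$\mathfrak{g}^{v}_{\Gamma,\mathrm{std}}\supseteq\mathfrak{g}_{\Gamma_v,\mathrm{free}} .$$ -/

import Mathlib

attribute [local instance 100] LieRing.ofAssociativeRing

namespace QAOA

noncomputable section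

/-- Operators on the Hilbert space `(ℂ²)^{⊗ ι}` of qubits labelled by `ι`, written as matrices in the
computational basis, which is indexed by the bit strings `ι → Fin 2`. -/
abbrev Op (ι : Type*) := Matrix (ι → Fin 2) (ι → Fin 2) ℂ

/-- The Pauli matrix `X`. -/
def pauliX : Matrix (Fin 2) (Fin 2) ℂ := !![0, 1; 1, 0]

/-- The Pauli matrix `Z`. -/
def pauliZ : Matrix (Fin 2) (Fin 2) ℂ := !![1, 0; 0, -1]

/-- The one-qubit operator `P` acting on the qubit `w`, tensored with the identity on all the other
qubits. -/
def localOp {ι : Type*} [Fintype ι] [DecidableEq ι] (w : ι) (P : Matrix (Fin 2) (Fin 2) ℂ) : Op ι :=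
  Matrix.of fun x y => if ∀ u, u ≠ w → x u = y u then P (x w) (y w) else 0

/-- The operator `X_w`. -/
def opX {ι : Type*} [Fintype ι] [DecidableEq ι] (w : ι) : Op ι := localOp w pauliX

/-- The operator `Z_w`. -/
def opZ {ι : Type*} [Fintype ι] [DecidableEq ι] (w : ι) : Op ι := localOp w pauliZ

theorem opZ_eq_diagonal {ι : Type*} [Fintype ι] [DecidableEq ι] (w : ι) :
    (opZ w : Op ι) = Matrix.diagonal fun x => if x w = 0 then 1 else -1 := by
  ext x y
  rw [opZ, localOp, Matrix.of_apply, Matrix.diagonal_apply]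
  by_cases hxy : x = y
  · subst hxy
    have h2 : ∀ a : Fin 2, pauliZ a a = if a = 0 then 1 else -1 := by
      intro a
      fin_cases a <;> simp [pauliZ]
    simp [h2]
  · rw [if_neg hxy]
    split_ifs with h
    · have hw : x w ≠ y w := by
        intro hw
        apply hxy
        funext u
        by_cases hu : u = w
        · rw [hu, hw]
        · exact h u hu
      have h2 : ∀ a b : Fin 2, a ≠ b → pauliZ a b = 0 := by
        intro a b
        fin_cases a <;> fin_cases b <;> simp [pauliZ]
      exact h2 _ _ hw
    · rfl

theorem opZ_mul_comm {ι : Type*} [Fintype ι] [DecidableEq ι] (w w' : ι) :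
    (opZ w * opZ w' : Op ι) = opZ w' * opZ w := by
  simp only [opZ_eq_diagonal, Matrix.diagonal_mul_diagonal, mul_comm]

/-- The operator `Z_w Z_{w'}` attached to the unordered pair `s(w, w')`. -/
def opZZ {ι : Type*} [Fintype ι] [DecidableEq ι] : Sym2 ι → Op ι :=
  Sym2.lift ⟨fun w w' => opZ w * opZ w', opZ_mul_comm⟩

/-- The free dynamical Lie algebra of a graph: the real Lie algebra generated by all `i X_w` for
vertices `w` and all `i Z_w Z_{w'}` for edges `w w'`, under the commutator bracket. -/
def freeDLA {ι : Type*} [Fintype ι] [DecidableEq ι] (H : SimpleGraph ι) :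
    LieSubalgebra ℝ (Op ι) :=
  LieSubalgebra.lieSpan ℝ (Op ι)
    ((Set.range fun w : ι => Complex.I • (opX w : Op ι)) ∪
      (fun e : Sym2 ι => Complex.I • (opZZ e : Op ι)) '' H.edgeSet)

/-- The reduced graph at `v`: the vertex `v` and all edges at `v` are removed. -/
abbrev reducedGraph {V : Type*} (G : SimpleGraph V) (v : V) : SimpleGraph {w : V // w ≠ v} :=
  G.comap Subtype.val

/-- The reduced mixer Hamiltonian `∑_{w ≠ v} X_w`. -/
def reducedMixer {V : Type*} [Fintype V] [DecidableEq V] (v : V) : Op {w : V // w ≠ v} :=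
  ∑ w : {w : V // w ≠ v}, opX w

/-- The reduced MaxCut Hamiltonian
`∑_{w w' ∈ E, w, w' ≠ v} Z_w Z_{w'} + ∑_{v w ∈ E} Z_w`. -/
def reducedProblem {V : Type*} [Fintype V] [DecidableEq V] (G : SimpleGraph V)
    [DecidableRel G.Adj] (v : V) : Op {w : V // w ≠ v} :=
  ∑ e ∈ (reducedGraph G v).edgeFinset, opZZ e +
    ∑ w : {w : V // w ≠ v} with G.Adj v w.1, opZ w

/-- The standard reduced dynamical Lie algebra of `(G, v)`: the real Lie algebra generated by
`i H_M^v` and `i H_P^v`. -/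
def standardReducedDLA {V : Type*} [Fintype V] [DecidableEq V] (G : SimpleGraph V)
    [DecidableRel G.Adj] (v : V) : LieSubalgebra ℝ (Op {w : V // w ≠ v}) :=
  LieSubalgebra.lieSpan ℝ (Op {w : V // w ≠ v})
    {Complex.I • reducedMixer v, Complex.I • reducedProblem G v}

/-- The sequence `(deg w_1, …, deg w_j)` modulo `2` along a walk `v = w_0, w_1, …, w_j = w`. -/
def parityProfile {V : Type*} [Fintype V] (G : SimpleGraph V)
    [DecidableRel G.Adj] {v w : V} (p : G.Walk v w) : List (ZMod 2) :=
  p.support.tail.map fun u => (G.degree u : ZMod 2)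

end

end QAOA

/-! Root the tree at `v`, write p(w) for the parent of w, and read Z_v as the identity. The problem
Hamiltonian becomes the sum over w ≠ v of the edge terms Z_{p(w)} Z_w, one for each non-root vertex.
Let M be the real space of all A with iA in the standard algebra; it is closed under `br`. It
suffices to find every X_w and every edge term in M.

Going down the tree. A polynomial in the adjoint action of the mixer separates the terms Z_w at the
neighbours of `v` from the two-body terms (`field_eq`). If the X-sum and the edge sum of a set C
with no parent-child pair inside it lie in M, the same sums for the children of C follow
(`sumE_kids_mem`, `sumX_kids_mem`). Moreover C splits by parity of degree: with S_u the sum of Z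
over the children of u, M contains the sum of X_u f(S_u²) over u in C for every real polynomial f,
and a suitable f turns S_u² into the parity of the number of children (`sumX_filter_odd_mem`). So M
contains the sums over each class of vertices with a common parity-degree sequence
(`sum_class_mem`).

Going up the tree. By hypothesis a class contains at most one leaf. Any other member has a child c
with X_c already in M; then c's edge term is in M and isolates the member from its class
(`opX_parent_mem`). Subtracting these members leaves the leaf (`opX_mem`). -/

namespace QAOA

noncomputable section

open Complex

/-! ### The Hermitian commutator -/

section Bracket

variable {R : Type*} [Ring R] [Algebra ℂ R]

/-- The rescaled commutator `(i / 2) [A, B]`, which sends Hermitian operators to Hermitian ones. -/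
def br (A B : R) : R := (I / 2) • (A * B - B * A)

theorem br_sum_left {α : Type*} (s : Finset α) (f : α → R) (B : R) :
    br (∑ a ∈ s, f a) B = ∑ a ∈ s, br (f a) B := by
  simp only [br, Finset.sum_mul, Finset.mul_sum, ← Finset.sum_sub_distrib, Finset.smul_sum]

theorem br_sum_right {α : Type*} (s : Finset α) (f : α → R) (A : R) :
    br A (∑ a ∈ s, f a) = ∑ a ∈ s, br A (f a) := by
  simp only [br, Finset.sum_mul, Finset.mul_sum, ← Finset.sum_sub_distrib, Finset.smul_sum]

theorem br_mul_right (A B C : R) : br A (B * C) = br A B * C + B * br A C := by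
  simp only [br, smul_mul_assoc, mul_smul_comm, ← smul_add]
  congr 1
  noncomm_ring

theorem br_add_right (A B C : R) : br A (B + C) = br A B + br A C := by
  simp only [br, ← smul_add]
  congr 1
  noncomm_ring

@[simp] theorem br_neg_right (A B : R) : br A (-B) = -br A B := by
  simp only [br, ← smul_neg]
  congr 1
  noncomm_ring

@[simp] theorem br_zero_right (A : R) : br A 0 = 0 := by simp [br]

theorem br_eq_zero {A B : R} (h : Commute A B) : br A B = 0 := by
  simp [br, h.eq]

theorem br_mul_mul {A B s t : R} (hsB : Commute s B) (htA : Commute t A) (hst : Commute s t) :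
    br (A * s) (B * t) = br A B * (s * t) := by
  simp only [br, smul_mul_assoc, sub_mul]
  congr 2
  · rw [mul_assoc, ← mul_assoc s, hsB.eq, mul_assoc, mul_assoc]
  · rw [mul_assoc, ← mul_assoc t, htA.eq, mul_assoc, mul_assoc, hst.eq]

/-- Cross terms vanish, so local commutators run in parallel over all of C. -/
theorem br_sum_sum {α : Type*} (C : Finset α) (a b : α → R)
    (h : ∀ c ∈ C, ∀ d ∈ C, c ≠ d → Commute (a c) (b d)) :
    br (∑ c ∈ C, a c) (∑ c ∈ C, b c) = ∑ c ∈ C, br (a c) (b c) := by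
  rw [br_sum_left]
  refine Finset.sum_congr rfl fun c hc => ?_
  rw [br_sum_right]
  refine Finset.sum_eq_single_of_mem c hc fun d hd hdc => ?_
  exact br_eq_zero (h c hc d hd hdc.symm)

end Bracket

/-! ### Bit flips -/

section FlipBit

variable {ι : Type*} [DecidableEq ι]

/-- The bit string `x` with its bit at `w` flipped. -/
def flipBit (w : ι) (x : ι → Fin 2) : ι → Fin 2 := Function.update x w (x w + 1)

theorem flipBit_same (w : ι) (x : ι → Fin 2) : flipBit w x w = x w + 1 := by
  simp [flipBit]

theorem flipBit_of_ne {u w : ι} (h : u ≠ w) (x : ι → Fin 2) : flipBit w x u = x u := by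
  simp [flipBit, h]

theorem flipBit_flipBit (w : ι) (x : ι → Fin 2) : flipBit w (flipBit w x) = x := by
  have h : ∀ a : Fin 2, a + 1 + 1 = a := by decide
  simp [flipBit, h]

theorem flipBit_comm (u w : ι) (x : ι → Fin 2) :
    flipBit u (flipBit w x) = flipBit w (flipBit u x) := by
  rcases eq_or_ne u w with rfl | h
  · rfl
  · simp only [flipBit, Function.update_of_ne h, Function.update_of_ne h.symm]
    exact Function.update_comm h.symm _ _ _

end FlipBit

/-! ### Pauli relations -/

section Pauli

variable {ι : Type*} [Fintype ι] [DecidableEq ι]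

theorem opX_apply (w : ι) (x y : ι → Fin 2) :
    (opX w : Op ι) x y = if y = flipBit w x then 1 else 0 := by
  have h2 : ∀ a b : Fin 2, pauliX a b = if b = a + 1 then 1 else 0 := by
    intro a b
    fin_cases a <;> fin_cases b <;> simp [pauliX]
  rw [opX, localOp, Matrix.of_apply, h2, ← ite_and]
  congr 1
  simp only [flipBit, Function.eq_update_iff, eq_iff_iff]
  exact ⟨fun h => ⟨h.2, fun u hu => (h.1 u hu).symm⟩, fun h => ⟨fun u hu => (h.2 u hu).symm, h.1⟩⟩

theorem opX_mul_apply (w : ι) (M : Op ι) (x y : ι → Fin 2) :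
    (opX w * M) x y = M (flipBit w x) y := by
  simp [Matrix.mul_apply, opX_apply]

theorem opX_mul_self (w : ι) : (opX w * opX w : Op ι) = 1 := by
  ext x y
  rw [opX_mul_apply, opX_apply, flipBit_flipBit, Matrix.one_apply]
  simp only [eq_comm]

theorem commute_opX_opX (u w : ι) : Commute (opX u : Op ι) (opX w) := by
  ext x y
  simp only [opX_mul_apply, opX_apply, flipBit_comm]

theorem opZ_mul_self (w : ι) : (opZ w * opZ w : Op ι) = 1 := by
  rw [opZ_eq_diagonal, Matrix.diagonal_mul_diagonal, ← Matrix.diagonal_one]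
  congr 1
  funext x
  split_ifs <;> simp

theorem commute_opZ_opZ (u w : ι) : Commute (opZ u : Op ι) (opZ w) := opZ_mul_comm u w

theorem opX_mul_diagonal (w : ι) (f : (ι → Fin 2) → ℂ) :
    (opX w * Matrix.diagonal f : Op ι) = Matrix.diagonal (fun x => f (flipBit w x)) * opX w := by
  ext x y
  rw [opX_mul_apply, Matrix.diagonal_mul, opX_apply, Matrix.diagonal_apply]
  simp only [eq_comm, mul_ite, mul_one, mul_zero]

theorem opZ_mul_opX (w : ι) : (opZ w * opX w : Op ι) = -(opX w * opZ w) := by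
  rw [opZ_eq_diagonal, opX_mul_diagonal, ← neg_mul, Matrix.diagonal_neg]
  congr 2
  funext x
  have h : ∀ a : Fin 2, (if a = 0 then 1 else -1 : ℂ) = -(if a + 1 = 0 then 1 else -1) := by
    intro a
    fin_cases a <;> simp
  simpa [flipBit_same] using h (x w)

theorem commute_opX_opZ {u w : ι} (h : u ≠ w) : Commute (opX u : Op ι) (opZ w) := by
  rw [Commute, SemiconjBy, opZ_eq_diagonal, opX_mul_diagonal]
  simp only [flipBit_of_ne h.symm]

/-- The operator `Y_w`. -/
def opY (w : ι) : Op ι := I • (opX w * opZ w)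

theorem commute_opX_opY {u w : ι} (h : u ≠ w) : Commute (opX u : Op ι) (opY w) :=
  ((commute_opX_opX u w).mul_right (commute_opX_opZ h)).smul_right I

theorem commute_opZ_opY {u w : ι} (h : u ≠ w) : Commute (opZ u : Op ι) (opY w) :=
  ((commute_opX_opZ h.symm).symm.mul_right (commute_opZ_opZ u w)).smul_right I

theorem br_opX_opZ_self (w : ι) : br (opX w : Op ι) (opZ w) = opY w := by
  rw [br, opZ_mul_opX, sub_neg_eq_add, ← two_smul ℂ, smul_smul, opY]
  congr 1
  ring

theorem br_opX_opY_self (w : ι) : br (opX w : Op ι) (opY w) = -opZ w := by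
  rw [br, opY, mul_smul_comm, smul_mul_assoc, mul_assoc (opX w) (opZ w), opZ_mul_opX, mul_neg,
    ← mul_assoc, opX_mul_self, one_mul, ← smul_sub, sub_neg_eq_add, ← two_smul ℂ, smul_smul,
    smul_smul, ← neg_one_smul ℂ]
  congr 1
  linear_combination I_mul_I

theorem br_opZ_opY_self (w : ι) : br (opZ w : Op ι) (opY w) = opX w := by
  rw [br, opY, mul_smul_comm, smul_mul_assoc, ← mul_assoc, opZ_mul_opX, neg_mul, mul_assoc,
    opZ_mul_self, mul_one, ← smul_sub, ← neg_add', ← two_smul ℂ, ← neg_smul, smul_smul,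
    smul_smul]
  nth_rewrite 2 [← one_smul ℂ (opX w)]
  congr 1
  linear_combination -I_mul_I

/-- The sum of the operators `X_w` over `w ∈ C`. -/
def sumX (C : Finset ι) : Op ι := ∑ w ∈ C, opX w

theorem br_sumX_opZ (C : Finset ι) (w : ι) :
    br (sumX C) (opZ w) = if w ∈ C then opY w else 0 := by
  rw [sumX, br_sum_left]
  split_ifs with h
  · rw [Finset.sum_eq_single_of_mem w h fun u _ hu => br_eq_zero (commute_opX_opZ hu),
      br_opX_opZ_self]
  · exact Finset.sum_eq_zero fun u hu => br_eq_zero (commute_opX_opZ fun e => h (e ▸ hu))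

theorem br_sumX_opY (C : Finset ι) (w : ι) :
    br (sumX C) (opY w) = if w ∈ C then -opZ w else 0 := by
  rw [sumX, br_sum_left]
  split_ifs with h
  · rw [Finset.sum_eq_single_of_mem w h fun u _ hu => br_eq_zero (commute_opX_opY hu),
      br_opX_opY_self]
  · exact Finset.sum_eq_zero fun u hu => br_eq_zero (commute_opX_opY fun e => h (e ▸ hu))

/-- The operator `Z_w`, extended by the identity to a missing qubit. -/
def optZ (o : Option ι) : Op ι := o.elim 1 opZ

/-- The operator `Y_w`, extended by zero to a missing qubit. -/
def optY (o : Option ι) : Op ι := o.elim 0 opY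

theorem br_sumX_optZ (C : Finset ι) (o : Option ι) :
    br (sumX C) (optZ o) = if o ∈ C.image some then optY o else 0 := by
  cases o with
  | none => simp [optZ, br]
  | some w => simp [optZ, optY, br_sumX_opZ]

theorem br_sumX_optY (C : Finset ι) (o : Option ι) :
    br (sumX C) (optY o) = if o ∈ C.image some then -optZ o else 0 := by
  cases o with
  | none => simp [optY]
  | some w => simp [optZ, optY, br_sumX_opY]

theorem optZ_mul_self (o : Option ι) : (optZ o * optZ o : Op ι) = 1 := by
  cases o with
  | none => simp [optZ]
  | some w => simp [optZ, opZ_mul_self]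

theorem commute_optZ_opZ (o : Option ι) (w : ι) : Commute (optZ o : Op ι) (opZ w) := by
  cases o with
  | none => simp [optZ]
  | some u => exact commute_opZ_opZ u w

theorem commute_optZ_optZ (o o' : Option ι) : Commute (optZ o : Op ι) (optZ o') := by
  cases o' with
  | none => simp [optZ]
  | some u => exact commute_optZ_opZ o u

theorem commute_optZ_opY {o : Option ι} {w : ι} (h : o ≠ some w) :
    Commute (optZ o : Op ι) (opY w) := by
  cases o with
  | none => simp [optZ]
  | some u => exact commute_opZ_opY fun e => h (e ▸ rfl)

end Pauli

/-! ### Edge sums of a rooted forest and passage to children -/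

section Forest

variable {ι : Type*} [Fintype ι] [DecidableEq ι]

/-- The sum of the operators `Z_{p(w)} Z_w` over `w ∈ C`, where `p` is a parent function. -/
def sumE (p : ι → Option ι) (C : Finset ι) : Op ι := ∑ w ∈ C, optZ (p w) * opZ w

/-- The sum of the operators `Z_{p(w)} Y_w` over `w ∈ C`, where `p` is a parent function. -/
def sumEY (p : ι → Option ι) (C : Finset ι) : Op ι := ∑ w ∈ C, optZ (p w) * opY w

/-- The vertices whose parent lies in `C`. -/
def kids (p : ι → Option ι) (C : Finset ι) : Finset ι := {w | p w ∈ C.image some}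

theorem mem_kids {p : ι → Option ι} {C : Finset ι} {w : ι} :
    w ∈ kids p C ↔ p w ∈ C.image some := by
  simp [kids]

/-- Since no parent end lies in A, only the child end of each edge is rotated. -/
theorem br_sumX_sumE {p : ι → Option ι} {A B : Finset ι} (h : ∀ w ∈ B, p w ∉ A.image some) :
    br (sumX A) (sumE p B) = sumEY p (A ∩ B) := by
  rw [sumE, br_sum_right, sumEY, Finset.inter_comm, ← Finset.filter_mem_eq_inter,
    Finset.sum_filter]
  refine Finset.sum_congr rfl fun w hw => ?_
  rw [br_mul_right, br_sumX_optZ, if_neg (h w hw), br_sumX_opZ, zero_mul, zero_add, mul_ite,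
    mul_zero]

theorem br_sumX_sumEY {p : ι → Option ι} {A B : Finset ι} (h : ∀ w ∈ B, p w ∉ A.image some) :
    br (sumX A) (sumEY p B) = -sumE p (A ∩ B) := by
  rw [sumEY, br_sum_right, sumE, Finset.inter_comm, ← Finset.filter_mem_eq_inter,
    Finset.sum_filter, ← Finset.sum_neg_distrib]
  refine Finset.sum_congr rfl fun w hw => ?_
  rw [br_mul_right, br_sumX_optZ, if_neg (h w hw), br_sumX_opY, zero_mul, zero_add, mul_ite,
    mul_zero]
  split_ifs <;> simp

theorem br_sumX_sumE_kids {p : ι → Option ι} {C B : Finset ι} (h : Disjoint B C) :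
    br (sumX C) (sumE p B) = ∑ w ∈ B ∩ kids p C, optY (p w) * opZ w := by
  rw [sumE, br_sum_right, ← Finset.filter_mem_eq_inter, Finset.sum_filter]
  refine Finset.sum_congr rfl fun w hw => ?_
  rw [br_mul_right, br_sumX_optZ, br_sumX_opZ, if_neg (Finset.disjoint_left.1 h hw), mul_zero,
    add_zero, ite_mul, zero_mul]
  simp only [mem_kids]

theorem br_sumX_sum_optY {p : ι → Option ι} {C B : Finset ι} (h : Disjoint B C)
    (hB : B ⊆ kids p C) :
    br (sumX C) (∑ w ∈ B, optY (p w) * opZ w) = -sumE p B := by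
  rw [sumE, br_sum_right, ← Finset.sum_neg_distrib]
  refine Finset.sum_congr rfl fun w hw => ?_
  rw [br_mul_right, br_sumX_optY, br_sumX_opZ, if_neg (Finset.disjoint_left.1 h hw), mul_zero,
    add_zero, if_pos (mem_kids.1 (hB hw)), neg_mul]

/-- Distinct edges can meet only at a parent, where both carry Z, so cross terms commute. On a
single edge the two parent factors square to 1, leaving (i/2)[Z_w, Y_w] = X_w. -/
theorem br_sumE_sumEY {p : ι → Option ι} {D : Finset ι} (h : ∀ w ∈ D, p w ∉ D.image some) :
    br (sumE p D) (sumEY p D) = sumX D := by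
  have hp : ∀ c ∈ D, ∀ d ∈ D, p c ≠ some d := fun c hc d hd e =>
    h c hc (e ▸ Finset.mem_image_of_mem _ hd)
  rw [sumE, sumEY, br_sum_sum, sumX]
  · refine Finset.sum_congr rfl fun w hw => ?_
    rw [(commute_optZ_opZ (p w) w).eq, (commute_optZ_opY (hp w hw w hw)).eq, br_mul_mul,
      br_opZ_opY_self, optZ_mul_self, mul_one]
    · exact commute_optZ_opY (hp w hw w hw)
    · exact commute_optZ_opZ _ _
    · exact commute_optZ_optZ _ _
  · intro c hc d hd hcd
    exact ((commute_optZ_optZ _ _).mul_right (commute_optZ_opY (hp c hc d hd))).mul_left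
      ((commute_optZ_opZ _ _).symm.mul_right (commute_opZ_opY hcd))

theorem sumE_add_sumE_compl (p : ι → Option ι) (C : Finset ι) :
    sumE p C + sumE p Cᶜ = sumE p Finset.univ :=
  Finset.sum_add_sum_compl C _

theorem sumX_add_sumX_compl (C : Finset ι) : sumX C + sumX Cᶜ = sumX Finset.univ :=
  Finset.sum_add_sum_compl C _

/-- Let D be the adjoint action of the mixer. On Z_w, D² is -1, so D⁴ + 4D² is 1 - 4 = -3. On Z_u
Z_w, D² has eigenvalues 0 and -4 only, so D⁴ + 4D² vanishes. -/
theorem field_eq (p : ι → Option ι) :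
    br (sumX Finset.univ) (br (sumX Finset.univ) (br (sumX Finset.univ) (br (sumX Finset.univ)
      (sumE p Finset.univ)))) + (4 : ℝ) • br (sumX Finset.univ) (br (sumX Finset.univ)
      (sumE p Finset.univ)) = (-3 : ℝ) • sumE p {w | p w = none} := by
  simp only [sumE, br_sum_right, Finset.smul_sum]
  rw [← Finset.sum_add_distrib, Finset.sum_filter]
  refine Finset.sum_congr rfl fun w _ => ?_
  cases h : p w with
  | none =>
    simp only [optZ, Option.elim_none, one_mul, br_sumX_opZ, br_sumX_opY, Finset.mem_univ, if_true,
      br_neg_right, neg_neg]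
    module
  | some u =>
    simp only [optZ, Option.elim_some, br_mul_right, br_add_right, br_sumX_opZ, br_sumX_opY,
      Finset.mem_univ, if_true, br_neg_right, reduceCtorEq, if_false, neg_mul, mul_neg]
    module

variable {M : Submodule ℝ (Op ι)} {p : ι → Option ι}

theorem sumE_inter_mem (hM : ∀ A ∈ M, ∀ B ∈ M, br A B ∈ M) {A B : Finset ι}
    (hA : sumX A ∈ M) (hB : sumE p B ∈ M) (h : ∀ w ∈ B, p w ∉ A.image some) :
    sumE p (A ∩ B) ∈ M := by
  have h1 := hM _ hA _ (hM _ hA _ hB)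
  rw [br_sumX_sumE h, br_sumX_sumEY fun w hw => h w (Finset.mem_inter.1 hw).2, ← Finset.inter_assoc,
    Finset.inter_self] at h1
  exact neg_mem_iff.1 h1

theorem sumX_mem_of_subset (hM : ∀ A ∈ M, ∀ B ∈ M, br A B ∈ M) {A D : Finset ι}
    (hA : sumX A ∈ M) (hD : sumE p D ∈ M) (hDA : D ⊆ A) (h : ∀ w ∈ D, p w ∉ A.image some) :
    sumX D ∈ M := by
  have h1 := hM _ hD _ (hM _ hA _ hD)
  rwa [br_sumX_sumE h, Finset.inter_eq_right.2 hDA, br_sumE_sumEY fun w hw hw' =>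
    h w hw (Finset.image_subset_image hDA hw')] at h1

theorem sumE_roots_mem (hM : ∀ A ∈ M, ∀ B ∈ M, br A B ∈ M) (hX : sumX Finset.univ ∈ M)
    (hE : sumE p Finset.univ ∈ M) : sumE p {w | p w = none} ∈ M := by
  have h2 := hM _ hX _ (hM _ hX _ hE)
  have h4 := hM _ hX _ (hM _ hX _ h2)
  have h := M.add_mem h4 (M.smul_mem (4 : ℝ) h2)
  rw [field_eq] at h
  exact (M.smul_mem_iff (by norm_num)).1 h

theorem sumX_roots_mem (hM : ∀ A ∈ M, ∀ B ∈ M, br A B ∈ M) (hX : sumX Finset.univ ∈ M)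
    (hE : sumE p Finset.univ ∈ M) : sumX {w | p w = none} ∈ M := by
  refine sumX_mem_of_subset hM hX (sumE_roots_mem hM hX hE) (Finset.subset_univ _) fun w hw => ?_
  rw [(Finset.mem_filter.1 hw).2]
  simp

theorem disjoint_kids {C : Finset ι} (h : ∀ w ∈ C, p w ∉ C.image some) :
    Disjoint (kids p C) C :=
  Finset.disjoint_right.2 fun w hw hw' => h w hw (mem_kids.1 hw')

/-- Once the edges from C up to its parents are removed, the remaining edges that meet C go down to
its children. The X-sum over C rotates their parent end only, so bracketing twice keeps exactly
these edges, up to sign. -/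
theorem sumE_kids_mem (hM : ∀ A ∈ M, ∀ B ∈ M, br A B ∈ M) (hE : sumE p Finset.univ ∈ M)
    {C : Finset ι} (hXC : sumX C ∈ M) (hEC : sumE p C ∈ M) (h : ∀ w ∈ C, p w ∉ C.image some) :
    sumE p (kids p C) ∈ M := by
  have h0 : sumE p Cᶜ ∈ M := by
    rw [← sumE_add_sumE_compl p C] at hE
    exact (M.add_mem_iff_right hEC).1 hE
  have h1 := hM _ hXC _ (hM _ hXC _ h0)
  have hk : kids p C ⊆ Cᶜ := Finset.subset_compl_iff_disjoint_right.2 (disjoint_kids h)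
  rw [br_sumX_sumE_kids disjoint_compl_left, Finset.inter_eq_right.2 hk,
    br_sumX_sum_optY (disjoint_kids h) subset_rfl] at h1
  exact neg_mem_iff.1 h1

theorem sumX_kids_mem (hM : ∀ A ∈ M, ∀ B ∈ M, br A B ∈ M) (hX : sumX Finset.univ ∈ M)
    (hE : sumE p Finset.univ ∈ M)
    {C : Finset ι} (hXC : sumX C ∈ M) (hEC : sumE p C ∈ M) (h : ∀ w ∈ C, p w ∉ C.image some) :
    sumX (kids p C) ∈ M := by
  have h0 : sumX Cᶜ ∈ M := by
    rw [← sumX_add_sumX_compl C] at hX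
    exact (M.add_mem_iff_right hXC).1 hX
  -- The complement of C contains the children but not their parents, as required of the rotating
  -- set.
  refine sumX_mem_of_subset hM h0 (sumE_kids_mem hM hE hXC hEC h)
    (Finset.subset_compl_iff_disjoint_right.2 (disjoint_kids h)) fun w hw hw' => ?_
  obtain ⟨c, hc, hcw⟩ := Finset.mem_image.1 (mem_kids.1 hw)
  obtain ⟨d, hd, hdw⟩ := Finset.mem_image.1 hw'
  obtain rfl := Option.some.inj (hcw.trans hdw.symm)
  exact Finset.mem_compl.1 hd hc

/-- The edge term Z_u Z_w meets C only at u, so the double bracket of the X-sum with it retains X_u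
alone. -/
theorem opX_parent_mem (hM : ∀ A ∈ M, ∀ B ∈ M, br A B ∈ M) {C : Finset ι} (hXC : sumX C ∈ M)
    {u w : ι} (hu : u ∈ C) (hw : w ∉ C) (hpw : p w = some u) (hEw : sumE p {w} ∈ M) :
    opX u ∈ M := by
  have h1 := hM _ hEw _ (hM _ hXC _ hEw)
  have huw : w ≠ u := fun e => hw (e ▸ hu)
  rw [br_sumX_sumE_kids (Finset.disjoint_singleton_left.2 hw), Finset.inter_eq_left.2, sumE,
    Finset.sum_singleton, Finset.sum_singleton, hpw, br_mul_mul] at h1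
  · simpa [optZ, optY, br_opZ_opY_self, opZ_mul_self] using h1
  · exact commute_opZ_opY huw
  · exact (commute_optZ_opZ _ _).symm
  · rfl
  · rw [Finset.singleton_subset_iff, mem_kids, hpw]
    exact Finset.mem_image_of_mem _ hu

end Forest

/-! ### Splitting a set by the parity of the number of children -/

section Split

variable {ι : Type*} [Fintype ι] [DecidableEq ι]

/-- The children of `u` for the parent function `p`. -/
def children (p : ι → Option ι) (u : ι) : Finset ι := {w | p w = some u}

/-- The sum of the operators `Z_w` over the children `w` of `u`. -/
def childZ (p : ι → Option ι) (u : ι) : Op ι := ∑ w ∈ children p u, opZ w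

/-- The eigenvalue of `childZ p u` at a bit string. -/
def childSum (p : ι → Option ι) (u : ι) (x : ι → Fin 2) : ℤ :=
  ∑ w ∈ children p u, if x w = 0 then 1 else -1

theorem childZ_eq_diagonal (p : ι → Option ι) (u : ι) :
    childZ p u = Matrix.diagonal fun x => (childSum p u x : ℂ) := by
  ext x y
  simp only [childZ, opZ_eq_diagonal, Matrix.sum_apply, Matrix.diagonal_apply, childSum]
  split_ifs with h
  · push_cast
    rfl
  · simp

theorem natAbs_childSum_le (p : ι → Option ι) (u : ι) (x : ι → Fin 2) :
    (childSum p u x).natAbs ≤ Fintype.card ι := by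
  refine (Int.natAbs_sum_le _ _).trans ((Finset.sum_le_card_nsmul _ _ 1 fun w _ => ?_).trans ?_)
  · split_ifs <;> simp
  · simpa using Finset.card_le_univ _

/-- Each summand is ±1, hence 1 modulo 2, whatever the bit string. -/
theorem odd_childSum (p : ι → Option ι) (u : ι) (x : ι → Fin 2) :
    Odd (childSum p u x).natAbs ↔ Odd (children p u).card := by
  rw [Int.natAbs_odd, ← Int.odd_coe_nat, childSum]
  have h : ((∑ w ∈ children p u, if x w = 0 then 1 else -1 : ℤ) : ZMod 2) =
      (((children p u).card : ℤ) : ZMod 2) := by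
    push_cast
    rw [Finset.card_eq_sum_ones, Nat.cast_sum]
    refine Finset.sum_congr rfl fun w _ => ?_
    split_ifs <;> decide
  rw [← Int.not_even_iff_odd, ← Int.not_even_iff_odd, ← ZMod.intCast_eq_zero_iff_even, h,
    ZMod.intCast_eq_zero_iff_even]

/-- Lagrange interpolation, the squares of distinct natural numbers being distinct. Squares appear
because only even powers of `childZ` will be available. -/
theorem exists_polynomial_sq_odd (N : ℕ) :
    ∃ q : Polynomial ℝ, ∀ n ≤ N, q.eval ((n : ℝ) ^ 2) = if Odd n then 1 else 0 := by
  refine ⟨Lagrange.interpolate (Finset.range (N + 1)) (fun n : ℕ => (n : ℝ) ^ 2)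
    fun n => if Odd n then 1 else 0, fun n hn => ?_⟩
  refine Lagrange.eval_interpolate_at_node (v := fun n : ℕ => (n : ℝ) ^ 2) _ (fun a _ b _ hab => ?_)
    (Finset.mem_range.2 (Nat.lt_succ_of_le hn))
  exact Nat.cast_injective ((sq_eq_sq₀ (Nat.cast_nonneg a) (Nat.cast_nonneg b)).1 hab)

/-- The polynomial acts on the diagonal entries, and all eigenvalues have the same parity, so the
result is a scalar matrix. -/
theorem aeval_childZ_sq {q : Polynomial ℝ}
    (hq : ∀ n ≤ Fintype.card ι, q.eval ((n : ℝ) ^ 2) = if Odd n then 1 else 0)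
    (p : ι → Option ι) (u : ι) :
    Polynomial.aeval (childZ p u ^ 2) q = if Odd (children p u).card then 1 else 0 := by
  have h1 : childZ p u ^ 2 = Matrix.diagonalAlgHom ℝ
      (fun x => algebraMap ℝ ℂ (((childSum p u x).natAbs : ℝ) ^ 2)) := by
    rw [childZ_eq_diagonal, Matrix.diagonal_pow]
    simp only [Matrix.diagonalAlgHom_apply]
    congr 1
    funext x
    rw [Pi.pow_apply, coe_algebraMap, Nat.cast_natAbs]
    push_cast
    rw [← ofReal_intCast, ← ofReal_pow, ← ofReal_pow, sq_abs]
  rw [h1, Polynomial.aeval_algHom_apply, Polynomial.aeval_pi_apply]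
  simp only [Polynomial.aeval_algebraMap_apply, Polynomial.coe_aeval_eq_eval,
    hq _ (natAbs_childSum_le p u _), odd_childSum, Matrix.diagonalAlgHom_apply]
  split_ifs <;> simp

theorem sumE_kids_eq (p : ι → Option ι) (C : Finset ι) :
    sumE p (kids p C) = ∑ u ∈ C, opZ u * childZ p u := by
  have h : kids p C = C.biUnion (children p) := by
    ext w
    simp [mem_kids, children, eq_comm]
  rw [sumE, h, Finset.sum_biUnion]
  · refine Finset.sum_congr rfl fun u _ => ?_
    rw [childZ, Finset.mul_sum]
    refine Finset.sum_congr rfl fun w hw => ?_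
    rw [(Finset.mem_filter.1 hw).2]
    rfl
  · intro u _ u' _ huu'
    refine Finset.disjoint_left.2 fun w hw hw' => huu' ?_
    exact Option.some.inj ((Finset.mem_filter.1 hw).2.symm.trans (Finset.mem_filter.1 hw').2)

theorem commute_opZ_childZ (p : ι → Option ι) (u w : ι) : Commute (opZ w) (childZ p u) :=
  Commute.sum_right _ _ _ fun _ _ => commute_opZ_opZ _ _

theorem commute_opX_childZ {p : ι → Option ι} {u w : ι} (h : w ∉ children p u) :
    Commute (opX w) (childZ p u) :=
  Commute.sum_right _ _ _ fun _ hc => commute_opX_opZ fun e => h (e ▸ hc)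

theorem commute_opY_childZ {p : ι → Option ι} {u w : ι} (h : w ∉ children p u) :
    Commute (opY w) (childZ p u) :=
  ((commute_opX_childZ h).mul_left (commute_opZ_childZ p u w)).smul_left I

theorem commute_childZ_childZ (p : ι → Option ι) (u w : ι) :
    Commute (childZ p w) (childZ p u) :=
  Commute.sum_left _ _ _ fun _ _ => commute_opZ_childZ _ _ _

variable {M : Submodule ℝ (Op ι)} {p : ι → Option ι}

/-- With S = `childZ p u`, bracketing with Z_u S sends X_u S^{2k} to Y_u S^{2k+1} and then to X_u
S^{2k+2}. Distinct members of C do not interact, because no member is a child of another. -/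
theorem sum_opX_mul_pow_mem (hM : ∀ A ∈ M, ∀ B ∈ M, br A B ∈ M) {C : Finset ι}
    (hXC : sumX C ∈ M) (hED : sumE p (kids p C) ∈ M) (h : ∀ w ∈ C, p w ∉ C.image some) (k : ℕ) :
    ∑ u ∈ C, opX u * (childZ p u ^ 2) ^ k ∈ M := by
  have hch : ∀ w ∈ C, ∀ u ∈ C, w ∉ children p u := fun w hw u hu hwu =>
    h w hw ((Finset.mem_filter.1 hwu).2 ▸ Finset.mem_image_of_mem _ hu)
  rw [sumE_kids_eq] at hED
  induction k with
  | zero => simpa [sumX] using hXC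
  | succ k ih =>
    have h1 := hM _ ih _ hED
    rw [br_sum_sum] at h1
    · have h2 := hM _ hED _ h1
      rw [br_sum_sum] at h2
      · convert h2 using 1
        refine Finset.sum_congr rfl fun u hu => ?_
        have hS := commute_childZ_childZ p u u
        have hx := commute_opX_childZ (hch u hu u hu)
        have hy := commute_opY_childZ (hch u hu u hu)
        have hz := commute_opZ_childZ p u u
        rw [br_mul_mul, br_opX_opZ_self, br_mul_mul, br_opZ_opY_self]
        · congr 1
          rw [← pow_mul, ← pow_mul, ← pow_succ, ← pow_succ']
          rfl
        · exact hy.symm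
        · exact (((hz.pow_right 2).pow_right k).mul_right hz).symm
        · exact (((hS.pow_right 2).pow_right k).mul_right hS)
        · exact ((hz.pow_right 2).pow_right k).symm
        · exact hx.symm
        · exact ((hS.pow_right 2).pow_right k).symm
      · intro c hc d hd hcd
        have hch' := commute_opX_childZ (hch d hd c hc)
        have hS := commute_childZ_childZ p d c
        have hz := commute_opZ_childZ p d c
        have hxz : Commute (opX d : Op ι) (opZ c) := commute_opX_opZ hcd.symm
        have hxS := commute_opX_childZ (hch d hd c hc)
        have key : Commute (opZ c * childZ p c) (opX d * (childZ p d ^ 2) ^ k) :=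
          ((hxz.symm.mul_left hxS.symm).mul_right
            (((hz.mul_left hS).pow_right 2).pow_right k))
        have key2 : Commute (opZ c * childZ p c) (opZ d * childZ p d) :=
          (((commute_opZ_opZ c d).mul_left (commute_opZ_childZ p c d).symm).mul_right
            (hz.mul_left hS))
        exact ((key.mul_right key2).sub_right (key2.mul_right key)).smul_right _
    · intro c hc d hd hcd
      have hS := commute_childZ_childZ p d c
      exact (((commute_opX_opZ hcd).mul_right (commute_opX_childZ (hch c hc d hd))).mul_left
        ((((commute_opZ_childZ p c d).symm.mul_right hS).pow_left 2).pow_left k))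

theorem sum_opX_mul_aeval_mem (hM : ∀ A ∈ M, ∀ B ∈ M, br A B ∈ M) {C : Finset ι}
    (hXC : sumX C ∈ M) (hED : sumE p (kids p C) ∈ M) (h : ∀ w ∈ C, p w ∉ C.image some)
    (q : Polynomial ℝ) : ∑ u ∈ C, opX u * Polynomial.aeval (childZ p u ^ 2) q ∈ M := by
  induction q using Polynomial.induction_on' with
  | add q r hq hr =>
    simp only [map_add, mul_add, Finset.sum_add_distrib]
    exact M.add_mem hq hr
  | monomial n a =>
    simp only [Polynomial.aeval_monomial, ← Algebra.smul_def, mul_smul_comm, ← Finset.smul_sum]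
    exact M.smul_mem a (sum_opX_mul_pow_mem hM hXC hED h n)

theorem sumX_filter_odd_mem (hM : ∀ A ∈ M, ∀ B ∈ M, br A B ∈ M) {C : Finset ι}
    (hXC : sumX C ∈ M) (hED : sumE p (kids p C) ∈ M) (h : ∀ w ∈ C, p w ∉ C.image some) :
    sumX {u ∈ C | Odd (children p u).card} ∈ M := by
  obtain ⟨q, hq⟩ := exists_polynomial_sq_odd (Fintype.card ι)
  have h1 := sum_opX_mul_aeval_mem hM hXC hED h q
  simp only [aeval_childZ_sq hq, mul_ite, mul_one, mul_zero] at h1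
  rwa [← Finset.sum_filter] at h1

theorem sumX_filter_parity_mem (hM : ∀ A ∈ M, ∀ B ∈ M, br A B ∈ M) {C : Finset ι}
    (hXC : sumX C ∈ M) (hED : sumE p (kids p C) ∈ M) (h : ∀ w ∈ C, p w ∉ C.image some)
    (a : ZMod 2) : sumX {u ∈ C | ((children p u).card + 1 : ZMod 2) = a} ∈ M := by
  have h1 := sumX_filter_odd_mem hM hXC hED h
  have hdec : ∀ x : ZMod 2, (x + 1 = 0 ↔ x = 1) ∧ (x + 1 = 1 ↔ ¬ x = 1) := by decide
  -- The degree is one more than the number of children, so value 0 means an odd number of children;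
  -- value 1 is the complement in C.
  obtain rfl | rfl : a = 0 ∨ a = 1 := by
    revert a
    decide
  · rwa [Finset.filter_congr fun u _ => (hdec _).1.trans ZMod.natCast_eq_one_iff_odd]
  · rw [sumX, ← Finset.sum_filter_add_sum_filter_not C fun u => Odd (children p u).card] at hXC
    rw [Finset.filter_congr fun u _ => (hdec _).2.trans (not_congr ZMod.natCast_eq_one_iff_odd)]
    exact (M.add_mem_iff_right h1).1 hXC

end Split

/-! ### Descent to parity classes, then ascent from the deepest vertices -/

section Descent

variable {ι : Type*} [Fintype ι] [DecidableEq ι] {M : Submodule ℝ (Op ι)} {p : ι → Option ι}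
  {prof : ι → List (ZMod 2)}

/-- Profiles are read from the vertex up to the root, so the tail is the parent's profile, and is
empty when the parent is the root. Induction on l carries along the children of the class, which the
next entry splits by parity. A vertex and its parent have profiles of different lengths, so no class
contains both. -/
theorem sum_class_mem (hM : ∀ A ∈ M, ∀ B ∈ M, br A B ∈ M) (hX : sumX Finset.univ ∈ M)
    (hE : sumE p Finset.univ ∈ M)
    (hprof : ∀ w, prof w = ((children p w).card + 1 : ZMod 2) :: (p w).elim [] prof)
    (l : List (ZMod 2)) :
    (sumX {w | prof w = l} ∈ M ∧ sumE p {w | prof w = l} ∈ M) ∧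
      sumX {w | (p w).elim [] prof = l} ∈ M ∧ sumE p {w | (p w).elim [] prof = l} ∈ M := by
  have hne : ∀ w, prof w ≠ (p w).elim [] prof := fun w e => by
    have := congrArg List.length (e.symm.trans (hprof w))
    simp at this
  have key : ∀ l, (∀ w ∈ ({w | prof w = l} : Finset ι),
      p w ∉ ({w | prof w = l} : Finset ι).image some) := by
    intro l w hw hw'
    obtain ⟨u, hu, huw⟩ := Finset.mem_image.1 hw'
    apply hne w
    rw [← huw, Option.elim_some, (Finset.mem_filter.1 hu).2, (Finset.mem_filter.1 hw).2]
  induction l with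
  | nil =>
    have h0 : ({w | prof w = []} : Finset ι) = ∅ := by
      refine Finset.filter_false_of_mem fun w _ => ?_
      rw [hprof]
      exact List.cons_ne_nil _ _
    have h1 : ({w | (p w).elim [] prof = []} : Finset ι) = ({w | p w = none} : Finset ι) := by
      refine Finset.filter_congr fun w _ => ?_
      cases p w with
      | none => simp
      | some u =>
        rw [Option.elim_some, hprof]
        simp
    rw [h0, h1]
    refine ⟨?_, sumX_roots_mem hM hX hE, sumE_roots_mem hM hX hE⟩
    simp [sumX, sumE]
  | cons a l ih =>
    obtain ⟨-, hXD, hED⟩ := ih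
    have hanti : ∀ w ∈ ({w | (p w).elim [] prof = l} : Finset ι),
        p w ∉ ({w | (p w).elim [] prof = l} : Finset ι).image some := by
      intro w hw hw'
      obtain ⟨u, hu, huw⟩ := Finset.mem_image.1 hw'
      apply hne u
      rw [(Finset.mem_filter.1 hu).2, ← (Finset.mem_filter.1 hw).2, ← huw, Option.elim_some]
    have hcl : ({w | prof w = a :: l} : Finset ι) =
        {u ∈ ({w | (p w).elim [] prof = l} : Finset ι) |
          ((children p u).card + 1 : ZMod 2) = a} := by
      ext w
      simp only [Finset.mem_filter, Finset.mem_univ, true_and]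
      rw [hprof w, List.cons.injEq, and_comm]
    have hXC : sumX {w | prof w = a :: l} ∈ M := by
      rw [hcl]
      exact sumX_filter_parity_mem hM hXD (sumE_kids_mem hM hE hXD hED hanti) hanti a
    have hsub : ({w | prof w = a :: l} : Finset ι) ⊆ ({w | (p w).elim [] prof = l} : Finset ι) := by
      rw [hcl]
      exact Finset.filter_subset _ _
    have hEC : sumE p {w | prof w = a :: l} ∈ M := by
      have := sumE_inter_mem hM hXC hED fun w hw hw' =>
        hanti w hw (Finset.image_subset_image hsub hw')
      rwa [Finset.inter_eq_left.2 hsub] at this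
    have hk : ({w | (p w).elim [] prof = a :: l} : Finset ι) = kids p {w | prof w = a :: l} := by
      ext w
      rw [mem_kids]
      cases h : p w <;> simp [h]
    refine ⟨⟨hXC, hEC⟩, ?_⟩
    rw [hk]
    exact ⟨sumX_kids_mem hM hX hE hXC hEC (key _), sumE_kids_mem hM hE hXC hEC (key _)⟩

/-- Within the edge sum of its own class, w occurs only as a child end, so bracketing twice with X_w
isolates its edge. -/
theorem sumE_singleton_mem (hM : ∀ A ∈ M, ∀ B ∈ M, br A B ∈ M) (hX : sumX Finset.univ ∈ M)
    (hE : sumE p Finset.univ ∈ M)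
    (hprof : ∀ w, prof w = ((children p w).card + 1 : ZMod 2) :: (p w).elim [] prof)
    {w : ι} (hw : opX w ∈ M) : sumE p {w} ∈ M := by
  obtain ⟨⟨-, hEC⟩, -⟩ := sum_class_mem hM hX hE hprof (prof w)
  have hw' : sumX {w} ∈ M := by simpa [sumX] using hw
  have h := sumE_inter_mem hM hw' hEC fun u hu hu' => ?_
  · rwa [Finset.inter_eq_left.2 (by simp)] at h
  · have hpu : p u = some w := by simpa using hu'
    have := congrArg List.length ((hprof u).symm.trans (Finset.mem_filter.1 hu).2)
    simp [hpu] at this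

theorem opX_mem (hM : ∀ A ∈ M, ∀ B ∈ M, br A B ∈ M) (hX : sumX Finset.univ ∈ M)
    (hE : sumE p Finset.univ ∈ M)
    (hprof : ∀ w, prof w = ((children p w).card + 1 : ZMod 2) :: (p w).elim [] prof)
    (hleaf : ∀ w w', children p w = ∅ → children p w' = ∅ → prof w = prof w' → w = w') (w : ι) :
    opX w ∈ M := by
  obtain ⟨N, hN⟩ : ∃ N, ∀ w, (prof w).length ≤ N :=
    ⟨Finset.univ.sup fun w => (prof w).length, fun w =>
      Finset.le_sup (f := fun w => (prof w).length) (Finset.mem_univ w)⟩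
  -- Induction from the deepest level upwards; for n = 0 the claim is vacuous, as N bounds all
  -- depths.
  have main : ∀ n w, N < (prof w).length + n → opX w ∈ M := by
    intro n
    induction n with
    | zero => exact fun w hw => absurd (hN w) (not_le.2 hw)
    | succ n ih =>
      have hinner : ∀ w, N < (prof w).length + (n + 1) → children p w ≠ ∅ → opX w ∈ M := by
        intro w hw hne
        obtain ⟨c, hc⟩ := Finset.nonempty_iff_ne_empty.2 hne
        have hpc : p c = some w := (Finset.mem_filter.1 hc).2
        have hlen : (prof c).length = (prof w).length + 1 := by
          rw [hprof c, hpc, Option.elim_some, List.length_cons]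
        refine opX_parent_mem hM (sum_class_mem hM hX hE hprof (prof w)).1.1 (by simp) ?_ hpc
          (sumE_singleton_mem hM hX hE hprof (ih c (by omega)))
        simp only [Finset.mem_filter, Finset.mem_univ, true_and]
        intro e
        rw [e] at hlen
        omega
      intro w hw
      by_cases hne : children p w = ∅
      · have hC := (sum_class_mem hM hX hE hprof (prof w)).1.1
        rw [sumX, ← Finset.add_sum_erase _ _
          (by simp : w ∈ ({u | prof u = prof w} : Finset ι))] at hC
        refine (M.add_mem_iff_left (M.sum_mem fun u hu => ?_)).1 hC
        have hu' : prof u = prof w := (Finset.mem_filter.1 (Finset.mem_of_mem_erase hu)).2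
        -- Every other member of the class has a child, since a second leaf with this profile would
        -- equal w.
        refine hinner u (by rwa [hu']) fun hu0 => ?_
        exact Finset.ne_of_mem_erase hu (hleaf u w hu0 hne hu')
      · exact hinner w hw hne
  exact main (N + 1) w (by omega)

end Descent

/-! ### Rooted trees: parents, degrees and the problem Hamiltonian -/

section Tree

variable {V : Type*} {G : SimpleGraph V} {v : V} (q : ∀ w, G.Walk v w)

theorem walk_eq_concat (hG : G.IsAcyclic) (hq : ∀ w, (q w).IsPath) {w : V} (hw : w ≠ v) :
    ∃ h, q w = (q (q w).penultimate).concat h := by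
  have hadj : G.Adj (q w).penultimate w :=
    (q w).adj_penultimate (SimpleGraph.Walk.not_nil_of_ne hw.symm)
  refine ⟨hadj, hG.path_concat (hq _) (hq w) hadj ?_⟩
  exact (q w).getVert_mem_support _

theorem walk_root_eq_nil (hq : ∀ w, (q w).IsPath) : q v = .nil :=
  (SimpleGraph.Walk.isPath_iff_nil.1 (hq v)).eq_nil

/-- By acyclicity, one endpoint of an edge lies on the chosen path to the other, and must then be
its penultimate vertex. -/
theorem penultimate_of_adj (hG : G.IsAcyclic) (hq : ∀ w, (q w).IsPath) {u w : V}
    (h : G.Adj u w) : (w ≠ v ∧ (q w).penultimate = u) ∨ (u ≠ v ∧ (q u).penultimate = w) := by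
  have key : ∀ {a b}, G.Adj a b → a ∈ (q b).support → b ≠ v ∧ (q b).penultimate = a := by
    intro a b hab ha
    refine ⟨?_, (hG.eq_penultimate_of_adj_end (hq b) hab.symm ha).symm⟩
    rintro rfl
    rw [walk_root_eq_nil q hq, SimpleGraph.Walk.support_nil, List.mem_singleton] at ha
    exact hab.ne ha
  by_cases hu : u ∈ (q w).support
  · exact .inl (key h hu)
  · exact .inr (key h.symm (hG.mem_support_of_ne_mem_support_of_adj_of_isPath (hq u) (hq w) h hu))

theorem penultimate_ne (hG : G.IsAcyclic) (hq : ∀ w, (q w).IsPath) {u w : V}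
    (hw : w ≠ v) (hu : u ≠ v) (h : (q w).penultimate = u) : (q u).penultimate ≠ w := by
  intro h'
  obtain ⟨hadj, e⟩ := walk_eq_concat q hG hq hw
  obtain ⟨hadj', e'⟩ := walk_eq_concat q hG hq hu
  have l := congrArg SimpleGraph.Walk.length e
  have l' := congrArg SimpleGraph.Walk.length e'
  rw [SimpleGraph.Walk.length_concat, h] at l
  rw [SimpleGraph.Walk.length_concat, h'] at l'
  omega

variable [DecidableEq V]

/-- The parent of a vertex of a tree with root `v`; the parent `v` is represented by `none`. -/
def treeParent (w : {w : V // w ≠ v}) : Option {w : V // w ≠ v} :=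
  if h : (q w).penultimate = v then none else some ⟨_, h⟩

theorem treeParent_eq_some {w u : {w : V // w ≠ v}} :
    treeParent q w = some u ↔ (q w).penultimate = u := by
  unfold treeParent
  split_ifs with h
  · simp only [false_iff]
    intro h'
    exact u.2 (h'.symm.trans h)
  · rw [Option.some.injEq, Subtype.ext_iff]

theorem treeParent_eq_none {w : {w : V // w ≠ v}} :
    treeParent q w = none ↔ (q w).penultimate = v := by
  unfold treeParent
  split_ifs with h <;> simp [h]

variable [Fintype V] [DecidableRel G.Adj]

theorem degree_eq (hG : G.IsAcyclic) (hq : ∀ w, (q w).IsPath) (w : {w : V // w ≠ v}) :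
    G.degree w = (children (treeParent q) w).card + 1 := by
  have h : G.neighborFinset w =
      insert (q w).penultimate ((children (treeParent q) w).image Subtype.val) := by
    ext u
    simp only [SimpleGraph.mem_neighborFinset, Finset.mem_insert, Finset.mem_image, children,
      Finset.mem_filter, Finset.mem_univ, true_and, treeParent_eq_some]
    constructor
    · intro h
      rcases penultimate_of_adj q hG hq h with ⟨hu, hp⟩ | ⟨-, hp⟩
      · exact .inr ⟨⟨u, hu⟩, hp, rfl⟩
      · exact .inl hp.symm
    · rintro (rfl | ⟨c, hc, rfl⟩)
      · exact (walk_eq_concat q hG hq w.2).1.symm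
      · have := (walk_eq_concat q hG hq c.2).1
        rwa [hc] at this
  rw [← SimpleGraph.card_neighborFinset_eq_degree, h, Finset.card_insert_of_notMem,
    Finset.card_image_of_injective _ Subtype.val_injective]
  simp only [Finset.mem_image, children, Finset.mem_filter, Finset.mem_univ, true_and,
    treeParent_eq_some, not_exists, not_and]
  intro c hc hc'
  exact penultimate_ne q hG hq c.2 w.2 hc hc'.symm

theorem parityProfile_reverse (hG : G.IsAcyclic) (hq : ∀ w, (q w).IsPath)
    (w : {w : V // w ≠ v}) :
    (parityProfile G (q w)).reverse = ((children (treeParent q) w).card + 1 : ZMod 2) ::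
      (treeParent q w).elim [] fun u => (parityProfile G (q u)).reverse := by
  have h1 : (treeParent q w).elim [] (fun u => (parityProfile G (q u)).reverse) =
      (parityProfile G (q (q w).penultimate)).reverse := by
    cases h : treeParent q w with
    | none =>
      rw [treeParent_eq_none] at h
      rw [Option.elim_none, h, walk_root_eq_nil q hq]
      simp [parityProfile]
    | some u =>
      rw [treeParent_eq_some] at h
      rw [Option.elim_some, h]
  obtain ⟨hadj, e⟩ := walk_eq_concat q hG hq w.2
  have h2 : parityProfile G (q w) =
      parityProfile G (q (q w).penultimate) ++ [(G.degree w : ZMod 2)] := by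
    conv_lhs => rw [e]
    rw [parityProfile, parityProfile, SimpleGraph.Walk.support_concat,
      List.tail_append_of_ne_nil (SimpleGraph.Walk.support_ne_nil _), List.map_append]
    rfl
  rw [h1, h2, List.reverse_append, degree_eq q hG hq]
  simp

theorem reducedProblem_eq (hG : G.IsAcyclic) (hq : ∀ w, (q w).IsPath) :
    reducedProblem G v = sumE (treeParent q) Finset.univ := by
  rw [reducedProblem, sumE, add_comm, ← Finset.sum_filter_add_sum_filter_not Finset.univ
    fun w : {w : V // w ≠ v} => treeParent q w = none]
  have hadj : ∀ w : {w : V // w ≠ v}, G.Adj (q w).penultimate w := fun w =>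
    (walk_eq_concat q hG hq w.2).1
  congr 1
  · have hf : ({w | G.Adj v w.1} : Finset {w : V // w ≠ v}) =
        ({w | treeParent q w = none} : Finset {w : V // w ≠ v}) := by
      refine Finset.filter_congr fun w _ => ?_
      rw [treeParent_eq_none]
      constructor
      · intro h
        rcases penultimate_of_adj q hG hq h with h | h
        · exact h.2
        · exact absurd rfl h.1
      · intro h
        have := hadj w
        rwa [h] at this
    rw [hf]
    refine Finset.sum_congr rfl fun w hw => ?_
    rw [(Finset.mem_filter.1 hw).2, optZ, Option.elim_none, one_mul]
  · symm
    have hex : ∀ w ∈ ({w | ¬treeParent q w = none} : Finset {w : V // w ≠ v}),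
        ∃ u, treeParent q w = some u := fun w hw =>
      Option.ne_none_iff_exists'.1 (Finset.mem_filter.1 hw).2
    choose f hf using hex
    -- Each edge avoiding the root is indexed by its child end. Injectivity holds because two
    -- vertices cannot be each other's parent.
    refine Finset.sum_bij (fun w hw => s(f w hw, w)) ?_ ?_ ?_ ?_
    · intro w hw
      have := hadj w
      rw [(treeParent_eq_some q).1 (hf w hw)] at this
      simpa using this
    · intro a ha b hb hab
      rcases Sym2.eq_iff.1 hab with h | h
      · exact h.2
      · refine absurd ?_ (penultimate_ne q hG hq a.2 b.2 ?_)
        · rw [(treeParent_eq_some q).1 (hf b hb), ← h.2]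
        · rw [(treeParent_eq_some q).1 (hf a ha), h.1]
    · intro e
      induction e using Sym2.ind with
      | _ a b =>
        intro he
        have hab : G.Adj a b := by simpa using he
        rcases penultimate_of_adj q hG hq hab with ⟨-, h⟩ | ⟨-, h⟩
        · have hb := (treeParent_eq_some q).2 h
          have hm : b ∈ ({w | ¬treeParent q w = none} : Finset {w : V // w ≠ v}) := by simp [hb]
          refine ⟨b, hm, ?_⟩
          rw [Option.some.inj ((hf b hm).symm.trans hb)]
        · have ha := (treeParent_eq_some q).2 h
          have hm : a ∈ ({w | ¬treeParent q w = none} : Finset {w : V // w ≠ v}) := by simp [ha]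
          refine ⟨a, hm, ?_⟩
          rw [Option.some.inj ((hf a hm).symm.trans ha), Sym2.eq_swap]
    · intro w hw
      rw [hf w hw]
      rfl

end Tree

/-! ### From the Lie algebra to Hermitian generators -/

section Lie

variable {ι : Type*} [Fintype ι] [DecidableEq ι]

/-- The operators `A` for which `i A` lies in a given Lie algebra. -/
def hamiltonians (g : LieSubalgebra ℝ (Op ι)) : Submodule ℝ (Op ι) :=
  g.toSubmodule.comap (DistribSMul.toLinearMap ℝ (Op ι) I)

theorem mem_hamiltonians {g : LieSubalgebra ℝ (Op ι)} {A : Op ι} :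
    A ∈ hamiltonians g ↔ I • A ∈ g := Iff.rfl

/-- Both i · (i/2)[A, B] and (1/2)[iA, iB] equal -(1/2)[A, B]. -/
theorem br_mem_hamiltonians (g : LieSubalgebra ℝ (Op ι)) :
    ∀ A ∈ hamiltonians g, ∀ B ∈ hamiltonians g, br A B ∈ hamiltonians g := by
  intro A hA B hB
  have h := g.smul_mem (1 / 2 : ℝ) (g.lie_mem hA hB)
  rw [mem_hamiltonians]
  convert h using 1
  change _ = (1 / 2 : ℝ) • ⁅I • A, I • B⁆
  rw [br, Ring.lie_def, smul_mul_smul_comm, smul_mul_smul_comm, ← smul_sub, smul_smul,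
    ← Complex.coe_smul, smul_smul]
  congr 1
  push_cast
  ring

end Lie

end

end QAOA

/-! ### The main theorem -/

theorem mainTheorem7 {V : Type*} [Fintype V] [DecidableEq V] (G : SimpleGraph V)
    [DecidableRel G.Adj] (hconn : G.Connected) (hacyc : G.IsAcyclic) (v : V)
    (hleaf : ∀ j : ℕ, 0 < j → ∀ w w' : V,
      G.dist v w = j → G.degree w = 1 → G.dist v w' = j → G.degree w' = 1 → w ≠ w' →
      ∀ (p : G.Path v w) (p' : G.Path v w'),
        QAOA.parityProfile G p.1 ≠ QAOA.parityProfile G p'.1) :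
    QAOA.freeDLA (QAOA.reducedGraph G v) ≤ QAOA.standardReducedDLA G v := by
  choose q hq hlen using hconn.exists_path_of_dist v
  have hM := QAOA.br_mem_hamiltonians (QAOA.standardReducedDLA G v)
  have hX : QAOA.sumX Finset.univ ∈ QAOA.hamiltonians (QAOA.standardReducedDLA G v) :=
    LieSubalgebra.subset_lieSpan (Set.mem_insert _ _)
  have hE : QAOA.sumE (QAOA.treeParent q) Finset.univ ∈
      QAOA.hamiltonians (QAOA.standardReducedDLA G v) := by
    rw [← QAOA.reducedProblem_eq q hacyc hq]
    exact LieSubalgebra.subset_lieSpan (Set.mem_insert_of_mem _ rfl)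
  have hprof := QAOA.parityProfile_reverse q hacyc hq
  have hopX := QAOA.opX_mem hM hX hE (prof := fun u : {w : V // w ≠ v} => (QAOA.parityProfile G (q u)).reverse) hprof
    (by
      intro w w' hw hw' h
      by_contra hne
      have hdeg : ∀ u, QAOA.children (QAOA.treeParent q) u = ∅ → G.degree u = 1 := fun u hu => by
        rw [QAOA.degree_eq q hacyc hq, hu, Finset.card_empty]
      -- Equal profiles have equal length, which is the distance to `v`, so the leaf hypothesis at
      -- that distance applies.
      have h' := List.reverse_injective h
      have hl := congrArg List.length h'
      simp only [QAOA.parityProfile, List.length_map, List.length_tail,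
        SimpleGraph.Walk.length_support, Nat.add_sub_cancel, hlen] at hl
      exact hleaf _ (hconn.pos_dist_of_ne w.2.symm) w w' rfl (hdeg w hw) hl.symm (hdeg w' hw')
        (fun e => hne (Subtype.ext e)) ⟨q w, hq w⟩ ⟨q w', hq w'⟩ h')
  refine LieSubalgebra.lieSpan_le.2 ?_
  rintro A (⟨w, rfl⟩ | ⟨e, he, rfl⟩)
  · exact hopX w
  · have key : ∀ a b, QAOA.treeParent q b = some a → Complex.I • (QAOA.opZ a * QAOA.opZ b) ∈
        QAOA.standardReducedDLA G v := by
      intro a b hab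
      have h := QAOA.sumE_singleton_mem hM hX hE
        (prof := fun u : {w : V // w ≠ v} => (QAOA.parityProfile G (q u)).reverse) hprof (hopX b)
      rw [QAOA.sumE, Finset.sum_singleton, hab] at h
      exact h
    induction e using Sym2.ind with
    | _ a b =>
      have hab : G.Adj a b := he
      rcases QAOA.penultimate_of_adj q hacyc hq hab with ⟨-, h⟩ | ⟨-, h⟩
      · exact key a b ((QAOA.treeParent_eq_some q).2 h)
      · rw [Sym2.eq_swap]
        exact key b a ((QAOA.treeParent_eq_some q).2 h)
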